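/- Let $R$ be a commutative ring with unit, $n\ge 1$, and $X=\{x_1<\dots<x_n\}$ an ordered alphabet. A Lie bracket on an $R$-module is a bilinear operation with $[x,y]=-[y,x]$ and $[x,[y,z]]+[y,[z,x]]+[z,[x,y]]=0$. Let $\mathscr{Lie}(n)$ be the multilinear part of the free Lie algebra on $X$ over $R$, i.e. the $R$-span of the bracket monomials containing each $x_i$ exactly once. Let $\mathscr{Lie}_2(n)$ be the multilinear part of the free $R$-algebra on $X$ with two compatible Lie brackets $[\cdot,\cdot]$ and $\langle\cdot,\cdot\rangle$, i.e. two Lie brackets satisfying $$[x,\langle y,z\rangle]+[y,\langle z,x\rangle]+[z,\langle x,y\rangle]+\langle x,[y,z]\rangle+\langle y,[z,x]\rangle+\langle z,[x,y]\rangle=0,$$ and let $\mathscr{Lie}_2(n,i)\subseteq\mathscr{Lie}_2(n)$ be the submodule generated by the multilinear monomials with exactly $i$ brackets $[\cdot,\cdot]$ (and $n-1-i$ brackets $\langle\cdot,\cdot\rangle$). Then: 1. There is an isomorphism of $R$-modules $\mathscr{Lie}(n)\cong\mathscr{Lie}_2(n,n-1)$ which sends the class of each multilinear monomial in $[\cdot,\cdot]$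 to the class of the same monomial in $\mathscr{Lie}_2(n)$. 2. $\mathscr{Lie}(n)$ and $\mathscr{Lie}_2(n,n-1)$ are free $R$-modules of rank $(n-1)!$, i.e. each has a basis with $(n-1)!$ elements. 3. $(n-1)!$ is the number of increasing trees on $n$ vertices, i.e. of rooted trees with vertex set $X$ in which every vertex other than the root is larger than its parent. -/

import Mathlib

open scoped Nat

namespace CompatibleLie

/-- Monomials in the letters `X` built with binary brackets, one bracket for each colour in `κ`. -/
inductive Mono (κ X : Type) : Type
  | letter (x : X) : Mono κ X
  | bracket (c : κ) (a b : Mono κ X) : Mono κ X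

namespace Mono

variable {κ κ' X : Type}

/-- The multiset of letters of a monomial, with multiplicity. -/
def letters : Mono κ X → Multiset X
  | letter x => {x}
  | bracket _ a b => a.letters + b.letters

/-- Every letter of the alphabet occurs exactly once. -/
def IsMultilinear [DecidableEq X] (m : Mono κ X) : Prop :=
  ∀ x : X, m.letters.count x = 1

/-- The number of brackets of colour `c` in a monomial. -/
def numBrackets [DecidableEq κ] (c : κ) : Mono κ X → ℕ
  | letter _ => 0
  | bracket d a b => (if d = c then 1 else 0) + a.numBrackets c + b.numBrackets c

/-- Replace every bracket of a monomial by the bracket of colour `c`. -/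
def paint (c : κ') : Mono κ X → Mono κ' X
  | letter x => letter x
  | bracket _ a b => bracket c (a.paint c) (b.paint c)

end Mono

noncomputable section

variable (R : Type*) [CommRing R] (κ X : Type)

/-- The free nonassociative `R`-algebra on `X` with one bilinear operation for each colour in `κ`,
without any relations: its elements are the formal `R`-linear combinations of monomials. -/
abbrev FreeOps : Type _ := Mono κ X →₀ R

variable {κ X}

/-- The bilinear operation of colour `c` on formal linear combinations of monomials. -/
def op (c : κ) : FreeOps R κ X →ₗ[R] FreeOps R κ X →ₗ[R] FreeOps R κ X :=
  Finsupp.linearCombination R fun a =>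
    Finsupp.linearCombination R fun b => Finsupp.single (Mono.bracket c a b) 1

variable (κ X)

/-- The relations for compatible Lie brackets: antisymmetry and the Jacobi identity for each
bracket, the mixed Jacobi identity for each pair of different brackets, and everything
obtained from these by applying brackets. For a single colour there is no mixed identity. -/
inductive IsRelation : FreeOps R κ X → Prop
  | antisymm (c : κ) (x y : FreeOps R κ X) : IsRelation (op R c x y + op R c y x)
  | jacobi (c : κ) (x y z : FreeOps R κ X) :
      IsRelation (op R c x (op R c y z) + op R c y (op R c z x) + op R c z (op R c x y))
  | mixedJacobi (c d : κ) (hcd : c ≠ d) (x y z : FreeOps R κ X) :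
      IsRelation (op R c x (op R d y z) + op R c y (op R d z x) + op R c z (op R d x y)
        + op R d x (op R c y z) + op R d y (op R c z x) + op R d z (op R c x y))
  | op_left (c : κ) (x r : FreeOps R κ X) : IsRelation r → IsRelation (op R c x r)
  | op_right (c : κ) (r x : FreeOps R κ X) : IsRelation r → IsRelation (op R c r x)

/-- The ideal generated by the relations. -/
def relations : Submodule R (FreeOps R κ X) :=
  Submodule.span R {r | IsRelation R κ X r}

/-- The free `R`-algebra on `X` with pairwise compatible Lie brackets indexed by `κ`. -/
abbrev Free : Type _ := FreeOps R κ X ⧸ relations R κ X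

variable {κ X}

/-- The element of the free algebra represented by a monomial. -/
def mono (m : Mono κ X) : Free R κ X :=
  (relations R κ X).mkQ (Finsupp.single m 1)

theorem op_mem_left (c : κ) (x : FreeOps R κ X) {r : FreeOps R κ X}
    (hr : r ∈ relations R κ X) : op R c x r ∈ relations R κ X := by
  induction hr using Submodule.span_induction with
  | mem r h => exact Submodule.subset_span (IsRelation.op_left c x r h)
  | zero => simp
  | add a b _ _ ha hb => simpa using Submodule.add_mem _ ha hb
  | smul t a _ ha => simpa using Submodule.smul_mem _ t ha

theorem op_mem_right (c : κ) (x : FreeOps R κ X) {r : FreeOps R κ X}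
    (hr : r ∈ relations R κ X) : op R c r x ∈ relations R κ X := by
  induction hr using Submodule.span_induction with
  | mem r h => exact Submodule.subset_span (IsRelation.op_right c r x h)
  | zero => simp
  | add a b _ _ ha hb => simpa using Submodule.add_mem _ ha hb
  | smul t a _ ha => simpa using Submodule.smul_mem _ t ha

/-- The bracket of colour `c` on the free algebra, induced by `op`. -/
def bracket (c : κ) : Free R κ X →ₗ[R] Free R κ X →ₗ[R] Free R κ X :=
  (relations R κ X).liftQ
    (LinearMap.flip ((relations R κ X).liftQ
      (LinearMap.flip ((op R c).compr₂ (relations R κ X).mkQ))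
      (fun r hr => by
        rw [LinearMap.mem_ker]
        refine LinearMap.ext fun x => ?_
        exact (Submodule.Quotient.mk_eq_zero _).2 (op_mem_left R c _ hr))))
    (fun r hr => by
      rw [LinearMap.mem_ker]
      refine LinearMap.ext fun q => ?_
      obtain ⟨y, rfl⟩ := (relations R κ X).mkQ_surjective q
      exact (Submodule.Quotient.mk_eq_zero _).2 (op_mem_right R c y hr))

@[simp] theorem bracket_mkQ (c : κ) (x y : FreeOps R κ X) :
    bracket R c ((relations R κ X).mkQ x) ((relations R κ X).mkQ y)
      = (relations R κ X).mkQ (op R c x y) := rfl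

theorem mono_bracket (c : κ) (a b : Mono κ X) :
    mono R (Mono.bracket c a b) = bracket R c (mono R a) (mono R b) := by
  simp [mono, op, -Submodule.mkQ_apply]

end

noncomputable section

variable (R : Type*) [CommRing R] (n : ℕ)

/-- The colours of the two compatible brackets: red is `[·,·]` and blue is `⟨·,·⟩`. -/
inductive Color : Type
  | red
  | blue
  deriving DecidableEq

/-- The free Lie algebra on the ordered alphabet `Fin n`: one bracket, subject to antisymmetry
and the Jacobi identity only. -/
abbrev FreeLie : Type _ := Free R Unit (Fin n)

/-- The free algebra on the ordered alphabet `Fin n` with two compatible Lie brackets. -/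
abbrev FreeLieTwo : Type _ := Free R Color (Fin n)

/-- `Lie(n)`: the multilinear part of the free Lie algebra on `n` letters. -/
def lie : Submodule R (FreeLie R n) :=
  Submodule.span R {v | ∃ m : Mono Unit (Fin n), m.IsMultilinear ∧ mono R m = v}

/-- `Lie₂(n)`: the multilinear part of the free algebra with two compatible Lie brackets. -/
def lieTwo : Submodule R (FreeLieTwo R n) :=
  Submodule.span R {v | ∃ m : Mono Color (Fin n), m.IsMultilinear ∧ mono R m = v}

/-- `Lie₂(n, i)`: the submodule of `Lie₂(n)` generated by the multilinear monomials with exactly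
`i` red brackets. -/
def lieTwoPart (i : ℕ) : Submodule R (lieTwo R n) :=
  Submodule.span R {v | ∃ m : Mono Color (Fin n),
    m.IsMultilinear ∧ m.numBrackets Color.red = i ∧ mono R m = (v : FreeLieTwo R n)}

variable {n}

theorem mono_mem_lie {m : Mono Unit (Fin n)} (hm : m.IsMultilinear) : mono R m ∈ lie R n :=
  Submodule.subset_span ⟨m, hm, rfl⟩

end

/-- A rooted tree on the vertex set `Fin n`. -/
structure RootedTree (n : ℕ) where
  graph : SimpleGraph (Fin n)
  isTree : graph.IsTree
  root : Fin n

/-- All edges are increasing: whenever `i` and `j` are joined by an edge and `i` is closer to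
the root than `j` (so that `i` is the parent of `j`), one has `i < j`. -/
def RootedTree.IsIncreasing {n : ℕ} (T : RootedTree n) : Prop :=
  ∀ i j : Fin n, T.graph.Adj i j → T.graph.dist T.root i < T.graph.dist T.root j → i < j

end CompatibleLie

/-! Painting brackets red maps the free Lie algebra into the free algebra with two compatible
brackets. Setting the blue bracket to zero gives a left inverse, because every term of the mixed
Jacobi identity contains a blue bracket; so no relation among red monomials is gained
(`paintRed_injective`). A multilinear monomial with n - 1 red brackets has no blue one, which
identifies the image of `lie` (`map_lie_paintRed`).

A basis of `lie` consists of the right-normed monomials ending in a fixed letter x₀ = 0, one for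
each ordering of the other n - 1 letters. Jacobi and antisymmetry show that they span
(`mono_mem_chainSpan`). They are independent because a suitable semidirect product sends them to
distinct words (`linearIndependent_chain`).

An increasing tree has root 0 and amounts to a free choice of a smaller parent for each other
vertex, giving 1 · 2 ⋯ (n - 1) trees. -/

namespace CompatibleLie

/-! ### Counting letters and brackets of monomials -/

namespace Mono

variable {κ X : Type} {A : Type*}

/-- The value of a monomial in an algebra with operations `B c` when the letters are given by
`g`. -/
def eval (B : κ → A → A → A) (g : X → A) : Mono κ X → A
  | letter x => g x
  | bracket c a b => B c (a.eval B g) (b.eval B g)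

theorem letters_paint {κ' : Type} (c : κ') (m : Mono κ X) :
    (m.paint c).letters = m.letters := by
  induction m with
  | letter x => rfl
  | bracket d a b ha hb => simp [paint, letters, ha, hb]

theorem isMultilinear_iff [Fintype X] [DecidableEq X] {m : Mono κ X} :
    m.IsMultilinear ↔ m.letters = Finset.univ.val := by
  rw [Multiset.ext, IsMultilinear]
  refine forall_congr' fun x => ?_
  rw [Multiset.count_eq_one_of_mem Finset.univ.nodup (Finset.mem_univ x)]

theorem numBrackets_lt_card_letters [DecidableEq κ] (c : κ) (m : Mono κ X) :
    m.numBrackets c < m.letters.card := by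
  induction m with
  | letter x => simp [numBrackets, letters]
  | bracket d a b ha hb =>
    simp only [numBrackets, letters, Multiset.card_add]
    split_ifs <;> omega

theorem numBrackets_paint [DecidableEq κ] (c : κ) {κ' : Type} (m : Mono κ' X) :
    (m.paint c).numBrackets c + 1 = m.letters.card := by
  induction m with
  | letter x => simp [numBrackets, letters, paint]
  | bracket d a b ha hb =>
    simp only [numBrackets, letters, paint, Multiset.card_add, if_true]
    omega

/-- The total number of brackets is one less than the number of letters, so the hypothesis leaves no
room for a bracket of another colour. -/
theorem paint_eq_self [DecidableEq κ] (c : κ) (m : Mono κ X)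
    (h : m.numBrackets c + 1 = m.letters.card) : m.paint c = m := by
  induction m with
  | letter x => rfl
  | bracket d a b ha hb =>
    have h1 := a.numBrackets_lt_card_letters c
    have h2 := b.numBrackets_lt_card_letters c
    simp only [numBrackets, letters, Multiset.card_add] at h
    split_ifs at h with hd
    · rw [paint, ha (by omega), hb (by omega), hd]
    · omega

theorem paint_paint {κ' κ'' : Type} (c : κ') (d : κ'') (m : Mono κ X) :
    (m.paint c).paint d = m.paint d := by
  induction m with
  | letter x => rfl
  | bracket e a b ha hb => simp [paint, ha, hb]

end Mono

/-! ### Universal property of the free algebra -/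

section Lift

variable {R : Type*} [CommRing R] {κ X : Type} {A : Type*} [AddCommGroup A] [Module R A]

/-- The operations `B c` are pairwise compatible Lie brackets. -/
structure AreCompatible (B : κ → A →ₗ[R] A →ₗ[R] A) : Prop where
  antisymm : ∀ c x y, B c x y + B c y x = 0
  jacobi : ∀ c x y z, B c x (B c y z) + B c y (B c z x) + B c z (B c x y) = 0
  mixedJacobi : ∀ c d, c ≠ d → ∀ x y z, B c x (B d y z) + B c y (B d z x) + B c z (B d x y)
    + B d x (B c y z) + B d y (B c z x) + B d z (B c x y) = 0

/-- The linear extension of the evaluation of monomials. -/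
noncomputable def evalOps (B : κ → A →ₗ[R] A →ₗ[R] A) (g : X → A) : FreeOps R κ X →ₗ[R] A :=
  Finsupp.linearCombination R (Mono.eval (fun c x y => B c x y) g)

theorem evalOps_op (B : κ → A →ₗ[R] A →ₗ[R] A) (g : X → A) (c : κ) (x y : FreeOps R κ X) :
    evalOps B g (op R c x y) = B c (evalOps B g x) (evalOps B g y) := by
  have h : (op R c).compr₂ (evalOps B g) = (B c).compl₁₂ (evalOps B g) (evalOps B g) := by
    ext a b
    simp [op, evalOps, Mono.eval]
  exact congr($h x y)

theorem AreCompatible.evalOps_eq_zero {B : κ → A →ₗ[R] A →ₗ[R] A} (hB : AreCompatible B)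
    (g : X → A) {r : FreeOps R κ X} (hr : r ∈ relations R κ X) : evalOps B g r = 0 := by
  suffices relations R κ X ≤ LinearMap.ker (evalOps B g) from this hr
  refine Submodule.span_le.2 fun r hr => ?_
  change evalOps B g r = 0
  replace hr : IsRelation R κ X r := hr
  induction hr with
  | antisymm c x y => simpa only [map_add, evalOps_op] using hB.antisymm c _ _
  | jacobi c x y z => simpa only [map_add, evalOps_op] using hB.jacobi c _ _ _
  | mixedJacobi c d hcd x y z =>
    simpa only [map_add, evalOps_op] using hB.mixedJacobi c d hcd _ _ _
  | op_left c x r hr ih => rw [evalOps_op, ih, map_zero]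
  | op_right c r x hr ih => rw [evalOps_op, ih, map_zero, LinearMap.zero_apply]

/-- The universal property of the free algebra with compatible Lie brackets. -/
noncomputable def AreCompatible.lift {B : κ → A →ₗ[R] A →ₗ[R] A} (hB : AreCompatible B)
    (g : X → A) : Free R κ X →ₗ[R] A :=
  (relations R κ X).liftQ (evalOps B g) fun _ hr => hB.evalOps_eq_zero g hr

theorem AreCompatible.lift_mono {B : κ → A →ₗ[R] A →ₗ[R] A} (hB : AreCompatible B)
    (g : X → A) (m : Mono κ X) :
    hB.lift g (mono R m) = m.eval (fun c x y => B c x y) g := by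
  simp [lift, mono, evalOps]

variable (R κ X)

theorem areCompatible_bracket : AreCompatible (bracket R : κ → Free R κ X →ₗ[R] _ →ₗ[R] _) where
  antisymm c x y := by
    obtain ⟨x, rfl⟩ := (relations R κ X).mkQ_surjective x
    obtain ⟨y, rfl⟩ := (relations R κ X).mkQ_surjective y
    simp only [bracket_mkQ, ← map_add]
    exact (Submodule.Quotient.mk_eq_zero _).2 (Submodule.subset_span (.antisymm c x y))
  jacobi c x y z := by
    obtain ⟨x, rfl⟩ := (relations R κ X).mkQ_surjective x
    obtain ⟨y, rfl⟩ := (relations R κ X).mkQ_surjective y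
    obtain ⟨z, rfl⟩ := (relations R κ X).mkQ_surjective z
    simp only [bracket_mkQ, ← map_add]
    exact (Submodule.Quotient.mk_eq_zero _).2 (Submodule.subset_span (.jacobi c x y z))
  mixedJacobi c d hcd x y z := by
    obtain ⟨x, rfl⟩ := (relations R κ X).mkQ_surjective x
    obtain ⟨y, rfl⟩ := (relations R κ X).mkQ_surjective y
    obtain ⟨z, rfl⟩ := (relations R κ X).mkQ_surjective z
    simp only [bracket_mkQ, ← map_add]
    exact (Submodule.Quotient.mk_eq_zero _).2 (Submodule.subset_span (.mixedJacobi c d hcd x y z))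

end Lift

/-! ### The free Lie algebra inside the two-bracket algebra -/

section Paint

variable (R : Type*) [CommRing R] (X : Type)

theorem areCompatible_red : AreCompatible
    (fun _ : Unit => (bracket R Color.red : Free R Color X →ₗ[R] _ →ₗ[R] _)) where
  antisymm _ := (areCompatible_bracket R Color X).antisymm _
  jacobi _ := (areCompatible_bracket R Color X).jacobi _
  mixedJacobi _ _ h := absurd rfl h

/-- The bracket of the free Lie algebra, paired with the zero blue bracket. -/
noncomputable def redOnly : Color → Free R Unit X →ₗ[R] Free R Unit X →ₗ[R] Free R Unit X
  | .red => bracket R ()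
  | .blue => 0

theorem areCompatible_redOnly : AreCompatible (redOnly R X) where
  antisymm c := by
    cases c
    · exact (areCompatible_bracket R Unit X).antisymm ()
    · simp [redOnly]
  jacobi c := by
    cases c
    · exact (areCompatible_bracket R Unit X).jacobi ()
    · simp [redOnly]
  mixedJacobi c d h := by
    cases c <;> cases d <;> first | exact absurd rfl h | simp [redOnly]

/-- The map from the free Lie algebra that replaces each bracket by the red bracket. -/
noncomputable def paintRed : Free R Unit X →ₗ[R] Free R Color X :=
  (areCompatible_red R X).lift fun x => mono R (.letter x)

variable {X}

theorem paintRed_mono (m : Mono Unit X) :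
    paintRed R X (mono R m) = mono R (m.paint Color.red) := by
  rw [paintRed, AreCompatible.lift_mono]
  induction m with
  | letter x => rfl
  | bracket c a b ha hb => simp only [Mono.eval, Mono.paint, mono_bracket, ha, hb]

theorem eval_redOnly_paint (m : Mono Unit X) :
    (m.paint Color.red).eval (fun c x y => redOnly R X c x y) (fun x => mono R (.letter x))
      = mono R m := by
  induction m with
  | letter x => rfl
  | bracket c a b ha hb => simp only [Mono.eval, Mono.paint, mono_bracket, ha, hb]; rfl

/-- The left inverse is the lift along `redOnly`, which kills every blue bracket. -/
theorem paintRed_injective : Function.Injective (paintRed R X) := by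
  have h : (areCompatible_redOnly R X).lift (fun x => mono R (.letter x)) ∘ₗ paintRed R X
      = LinearMap.id := by
    refine Submodule.linearMap_qext _ (Finsupp.lhom_ext' fun m => LinearMap.ext_ring ?_)
    change (areCompatible_redOnly R X).lift _ (paintRed R X (mono R m)) = mono R m
    rw [paintRed_mono, AreCompatible.lift_mono, eval_redOnly_paint]
  exact Function.LeftInverse.injective fun x => congr($h x)

variable {n : ℕ}

theorem map_lie_paintRed (hn : 1 ≤ n) : (lie R n).map (paintRed R (Fin n))
    = (lieTwoPart R n (n - 1)).map (lieTwo R n).subtype := by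
  rw [lie, lieTwoPart, Submodule.map_span, Submodule.map_span]
  congr 1
  ext v
  constructor
  · rintro ⟨_, ⟨m, hm, rfl⟩, rfl⟩
    have hm' := Mono.isMultilinear_iff.1 hm
    have hp : (m.paint Color.red).IsMultilinear := by
      rw [Mono.isMultilinear_iff, Mono.letters_paint, hm']
    have hc := Mono.numBrackets_paint Color.red m
    rw [hm', Finset.card_val, Finset.card_univ, Fintype.card_fin] at hc
    exact ⟨⟨mono R (m.paint Color.red), Submodule.subset_span ⟨_, hp, rfl⟩⟩,
      ⟨_, hp, by omega, rfl⟩, (paintRed_mono R m).symm⟩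
  · rintro ⟨w, ⟨m, hm, hc, hw⟩, rfl⟩
    have hm' := Mono.isMultilinear_iff.1 hm
    -- Here `1 ≤ n` is needed, so that n - 1 red brackets really is one less than the n letters.
    have hp : m.paint Color.red = m := Mono.paint_eq_self _ _ (by
      rw [hm', Finset.card_val, Finset.card_univ, Fintype.card_fin]; omega)
    refine ⟨_, ⟨m.paint (), ?_, rfl⟩, ?_⟩
    · rw [Mono.isMultilinear_iff, Mono.letters_paint, hm']
    · rw [paintRed_mono, Mono.paint_paint, hp, hw]; rfl

/-- `Lie(n)` is the part of `Lie₂(n)` without blue brackets. -/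
noncomputable def lieEquiv (hn : 1 ≤ n) : lie R n ≃ₗ[R] lieTwoPart R n (n - 1) :=
  Submodule.equivMapOfInjective _ (paintRed_injective R) (lie R n)
    ≪≫ₗ LinearEquiv.ofEq _ _ (map_lie_paintRed R hn)
    ≪≫ₗ (Submodule.equivMapOfInjective _ (lieTwo R n).subtype_injective
      (lieTwoPart R n (n - 1))).symm

theorem coe_lieEquiv (hn : 1 ≤ n) (v : lie R n) :
    ((lieEquiv R hn v : lieTwo R n) : FreeLieTwo R n) = paintRed R (Fin n) v := by
  have h := congrArg Subtype.val ((Submodule.equivMapOfInjective _ (lieTwo R n).subtype_injective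
      (lieTwoPart R n (n - 1))).apply_symm_apply
      (LinearEquiv.ofEq _ _ (map_lie_paintRed R hn)
        (Submodule.equivMapOfInjective _ (paintRed_injective R) (lie R n) v)))
  exact h

end Paint

/-! ### Right-normed basis of the multilinear part -/

section Basis

/-- The right-normed monomial `[a₁, [a₂, … [aₘ, x₀]]]`. -/
def chain {X : Type} (x₀ : X) (l : List X) : Mono Unit X :=
  l.foldr (fun a m => .bracket () (.letter a) m) (.letter x₀)

theorem letters_chain {X : Type} (x₀ : X) (l : List X) :
    (chain x₀ l).letters = x₀ ::ₘ (l : Multiset X) := by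
  induction l with
  | nil => rfl
  | cons a l ih =>
    change {a} + (chain x₀ l).letters = _
    rw [ih, Multiset.singleton_add, Multiset.cons_swap, Multiset.cons_coe]

variable (R : Type*) [CommRing R] {X : Type} (x₀ : X)

/-- The span of the right-normed monomials ending in `x₀` whose other letters form `s`. -/
noncomputable def chainSpan (s : Multiset X) : Submodule R (Free R Unit X) :=
  Submodule.span R {v | ∃ l : List X, (l : Multiset X) = s ∧ mono R (chain x₀ l) = v}

/-- By Jacobi, ad [a, b] is the commutator of ad a and ad b, so the action of a monomial reduces to
that of single letters, each of which lengthens a chain by one. The set `s` and `v` vary because the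
induction hypotheses are applied one after the other. -/
theorem bracket_mem_chainSpan (m : Mono Unit X) : ∀ {s : Multiset X} {v : Free R Unit X},
    v ∈ chainSpan R x₀ s → bracket R () (mono R m) v ∈ chainSpan R x₀ (m.letters + s) := by
  induction m with
  | letter x =>
    intro s v hv
    induction hv using Submodule.span_induction with
    | mem v h =>
      obtain ⟨l, rfl, rfl⟩ := h
      refine Submodule.subset_span ⟨x :: l, ?_, mono_bracket R () _ _⟩
      rw [Mono.letters, Multiset.singleton_add, Multiset.cons_coe]
    | zero => simp
    | add a b _ _ ha hb => simpa using Submodule.add_mem _ ha hb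
    | smul t a _ ha => simpa using Submodule.smul_mem _ t ha
  | bracket c a b ha hb =>
    intro s v hv
    have hj := (areCompatible_bracket R Unit X).jacobi () (mono R a) (mono R b) v
    have ha' := (areCompatible_bracket R Unit X).antisymm () v (mono R a)
    have hab := (areCompatible_bracket R Unit X).antisymm () v
      (bracket R () (mono R a) (mono R b))
    rw [eq_neg_of_add_eq_zero_left ha', eq_neg_of_add_eq_zero_left hab, map_neg] at hj
    have h : bracket R () (mono R (.bracket c a b)) v
        = bracket R () (mono R a) (bracket R () (mono R b) v)
          - bracket R () (mono R b) (bracket R () (mono R a) v) := by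
      rw [mono_bracket, ← sub_eq_zero, ← neg_eq_zero, ← hj]
      abel
    rw [h]
    refine Submodule.sub_mem _ ?_ ?_
    · rw [Mono.letters, add_assoc]
      exact ha (hb hv)
    · rw [Mono.letters, add_comm a.letters, add_assoc]
      exact hb (ha hv)

/-- Antisymmetry moves a factor containing x₀ to the right; that factor is a combination of chains,
on which the other factor acts. -/
theorem mono_mem_chainSpan [DecidableEq X] (m : Mono Unit X) (hm : x₀ ∈ m.letters) :
    mono R m ∈ chainSpan R x₀ (m.letters.erase x₀) := by
  induction m with
  | letter x =>
    obtain rfl : x₀ = x := by simpa [Mono.letters] using hm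
    exact Submodule.subset_span ⟨[], by simp [Mono.letters], rfl⟩
  | bracket c a b ha hb =>
    by_cases h : x₀ ∈ b.letters
    · rw [mono_bracket, Mono.letters, Multiset.erase_add_right_pos _ h]
      exact bracket_mem_chainSpan R x₀ a (hb h)
    · have h' : x₀ ∈ a.letters := by simpa [Mono.letters, h] using hm
      rw [mono_bracket, eq_neg_of_add_eq_zero_left
        ((areCompatible_bracket R Unit X).antisymm () (mono R a) (mono R b)), Mono.letters,
        Multiset.erase_add_left_pos _ h', add_comm]
      exact Submodule.neg_mem _ (bracket_mem_chainSpan R x₀ b (ha h'))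

section Semidirect

variable (A V : Type*) [Ring A] [Algebra R A] [AddCommGroup V] [Module R V] [Module A V]
  [IsScalarTower R A V] [SMulCommClass R A V]

/-- The bracket of the semidirect product of an associative algebra, with the commutator
bracket, and a module over it. -/
def semidirectBracket : (A × V) →ₗ[R] (A × V) →ₗ[R] (A × V) :=
  LinearMap.mk₂ R (fun a b => (a.1 * b.1 - b.1 * a.1, a.1 • b.2 - b.1 • a.2))
    (fun a b c => by ext1 <;> simp [add_mul, mul_add, add_smul] <;> abel)
    (fun t a b => by ext1 <;> simp [smul_sub, smul_comm b.1 t])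
    (fun a b c => by ext1 <;> simp [add_mul, mul_add, add_smul] <;> abel)
    (fun t a b => by ext1 <;> simp [smul_sub, smul_comm a.1 t])

theorem areCompatible_semidirectBracket :
    AreCompatible (fun _ : Unit => semidirectBracket R A V) where
  antisymm _ x y := by ext1 <;> simp [semidirectBracket]
  jacobi _ x y z := by
    ext1
    · simp only [semidirectBracket, LinearMap.mk₂_apply, Prod.fst_add, Prod.fst_zero]
      noncomm_ring
    · simp only [semidirectBracket, LinearMap.mk₂_apply, Prod.snd_add, Prod.snd_zero, smul_sub,
        sub_smul, mul_smul]
      abel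
  mixedJacobi _ _ h := absurd rfl h

end Semidirect

open Classical in
/-- The last letter goes to the empty word, every other letter to the operator that puts it in
front of a word. -/
noncomputable def letterValue (x : X) : Module.End R (List X →₀ R) × (List X →₀ R) :=
  if x = x₀ then (0, Finsupp.single [] 1) else (Finsupp.lmapDomain R R (List.cons x), 0)

/-- Each letter other than x₀ is a pure operator and the value of the remaining chain a pure vector,
so bracketing them just prepends the letter to a word. -/
theorem eval_chain (l : List X) (hl : x₀ ∉ l) :
    (chain x₀ l).eval (fun _ x y => semidirectBracket R _ _ x y) (letterValue R x₀)
      = (0, Finsupp.single l 1) := by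
  induction l with
  | nil => simp [chain, Mono.eval, letterValue]
  | cons a l ih =>
    rw [List.mem_cons, not_or] at hl
    change semidirectBracket R _ _ (letterValue R x₀ a) ((chain x₀ l).eval _ _) = _
    rw [ih hl.2, letterValue, if_neg (Ne.symm hl.1)]
    refine Prod.ext ?_ ?_
    · change Finsupp.lmapDomain R R (List.cons a) * (0 : Module.End R (List X →₀ R))
        - 0 * Finsupp.lmapDomain R R (List.cons a) = 0
      rw [mul_zero, zero_mul]
      exact sub_self (0 : Module.End R (List X →₀ R))
    · simp [semidirectBracket]

/-- The vector component of the semidirect product sends each chain to the basis vector of its own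
word, and independence pulls back along a linear map. -/
theorem linearIndependent_chain :
    LinearIndependent R fun l : {l : List X // x₀ ∉ l} => mono R (chain x₀ l.1) := by
  refine LinearIndependent.of_comp (LinearMap.snd R _ _ ∘ₗ
    (areCompatible_semidirectBracket R (Module.End R (List X →₀ R)) _).lift
      (letterValue R x₀)) ?_
  have h := (Finsupp.linearIndependent_single_one R (List X)).comp
    (Subtype.val : {l : List X // x₀ ∉ l} → List X) Subtype.val_injective
  convert h using 1
  funext l
  simp [AreCompatible.lift_mono, eval_chain R x₀ l.1 l.2]

variable (n : ℕ) [NeZero n]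

theorem lie_eq_chainSpan :
    lie R n = chainSpan R 0 ((Finset.univ : Finset (Fin n)).val.erase 0) := by
  refine le_antisymm (Submodule.span_le.2 ?_) (Submodule.span_le.2 ?_)
  · rintro _ ⟨m, hm, rfl⟩
    rw [Mono.isMultilinear_iff] at hm
    rw [← hm]
    exact mono_mem_chainSpan R 0 m (by rw [hm]; exact Finset.mem_univ (0 : Fin n))
  · rintro _ ⟨l, hl, rfl⟩
    refine Submodule.subset_span ⟨_, ?_, rfl⟩
    rw [Mono.isMultilinear_iff, letters_chain, hl]
    exact Multiset.cons_erase (Finset.mem_univ (0 : Fin n))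

/-- The arrangements of the nonzero elements of `Fin n`. -/
abbrev Arrangement : Type :=
  {l : List (Fin n) // l ∈ ((Finset.univ : Finset (Fin n)).toList.erase 0).permutations}

theorem mem_arrangement (l : List (Fin n)) :
    l ∈ ((Finset.univ : Finset (Fin n)).toList.erase 0).permutations ↔
      (l : Multiset (Fin n)) = (Finset.univ : Finset (Fin n)).val.erase 0 := by
  rw [List.mem_permutations, ← Multiset.coe_eq_coe, ← Multiset.coe_erase, Finset.coe_toList]

theorem zero_notMem_arrangement (l : Arrangement n) : 0 ∉ l.1 := by
  rw [← Multiset.mem_coe, (mem_arrangement n l.1).1 l.2]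
  exact (Finset.univ : Finset (Fin n)).nodup.notMem_erase

theorem card_arrangement : Nat.card (Arrangement n) = (n - 1)! := by
  have hnd : ((Finset.univ : Finset (Fin n)).toList.erase 0).permutations.Nodup :=
    List.nodup_permutations _ ((Finset.nodup_toList _).erase _)
  rw [Nat.card_eq_fintype_card, Fintype.card_of_subtype
    ((Finset.univ : Finset (Fin n)).toList.erase 0).permutations.toFinset (by simp),
    List.toFinset_card_of_nodup hnd, List.length_permutations, List.length_erase_of_mem (by simp),
    Finset.length_toList, Finset.card_univ, Fintype.card_fin]

theorem nonempty_basis_lie : Nonempty (Module.Basis (Fin (n - 1)!) R (lie R n)) := by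
  have hli : LinearIndependent R fun l : Arrangement n => mono R (chain 0 l.1) :=
    (linearIndependent_chain R (0 : Fin n)).comp
      (fun l : Arrangement n => ⟨l.1, zero_notMem_arrangement n l⟩)
      fun a b h => Subtype.ext (congrArg (fun x => x.1) h)
  have hspan : Submodule.span R (Set.range fun l : Arrangement n => mono R (chain 0 l.1))
      = lie R n := by
    rw [lie_eq_chainSpan, chainSpan]
    congr 1
    ext v
    constructor
    · rintro ⟨l, rfl⟩
      exact ⟨l.1, (mem_arrangement n _).1 l.2, rfl⟩
    · rintro ⟨l, hl, rfl⟩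
      exact ⟨⟨l, (mem_arrangement n _).2 hl⟩, rfl⟩
  exact ⟨((Module.Basis.span hli).map (LinearEquiv.ofEq _ _ hspan)).reindex
    (Finite.equivFinOfCardEq (card_arrangement n))⟩

end Basis

/-! ### Increasing trees as parent functions -/

section Trees

variable {k : ℕ}

/-- The graph on `Fin (k + 1)` in which `i + 1` is joined to `p i ≤ i`. -/
def parentGraph (p : ∀ i : Fin k, Fin (i + 1)) : SimpleGraph (Fin (k + 1)) where
  Adj a b := ∃ i : Fin k, (b = i.succ ∧ (a : ℕ) = p i) ∨ (a = i.succ ∧ (b : ℕ) = p i)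
  symm.symm a b := by
    rintro ⟨i, h⟩
    exact ⟨i, h.symm⟩
  loopless.irrefl a := by
    rintro ⟨i, ⟨rfl, h⟩ | ⟨rfl, h⟩⟩ <;> simp only [Fin.val_succ] at h <;> omega

/-- The vertex `p i`. -/
def parentVertex (p : ∀ i : Fin k, Fin (i + 1)) (i : Fin k) : Fin (k + 1) :=
  ⟨p i, by omega⟩

theorem parentVertex_lt (p : ∀ i : Fin k, Fin (i + 1)) (i : Fin k) :
    parentVertex p i < i.succ := by
  simp only [Fin.lt_def, parentVertex, Fin.val_succ]; omega

theorem parentGraph_adj_succ (p : ∀ i : Fin k, Fin (i + 1)) (i : Fin k) :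
    (parentGraph p).Adj (parentVertex p i) i.succ :=
  ⟨i, Or.inl ⟨rfl, rfl⟩⟩

theorem parentGraph_adj_of_lt {p : ∀ i : Fin k, Fin (i + 1)} {a b : Fin (k + 1)}
    (h : (parentGraph p).Adj a b) (hab : a < b) :
    ∃ i : Fin k, b = i.succ ∧ a = parentVertex p i := by
  obtain ⟨i, ⟨h1, h2⟩ | ⟨h1, h2⟩⟩ := h
  · exact ⟨i, h1, Fin.ext h2⟩
  · subst h1
    have := (p i).2
    simp only [Fin.lt_def, Fin.val_succ] at hab
    omega

theorem parentGraph_connected (p : ∀ i : Fin k, Fin (i + 1)) : (parentGraph p).Connected := by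
  have h : ∀ d : ℕ, ∀ v : Fin (k + 1), (v : ℕ) = d → (parentGraph p).Reachable 0 v := by
    intro d
    induction d using Nat.strong_induction_on with
    | _ d ih =>
      intro v hv
      cases v using Fin.cases with
      | zero => exact .refl _
      | succ i =>
        exact (ih _ (hv ▸ parentVertex_lt p i) _ rfl).trans (parentGraph_adj_succ p i).reachable
  exact (SimpleGraph.connected_iff_exists_forall_reachable _).2 ⟨0, fun v => h _ v rfl⟩

/-- Joining a vertex to a smaller one determines the vertex from the edge. -/
theorem succ_edge_injective {q : Fin k → Fin (k + 1)} (hq : ∀ i, q i < i.succ) :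
    Function.Injective fun i : Fin k => s(q i, i.succ) := by
  intro i j h
  rcases Sym2.eq_iff.1 h with ⟨_, h⟩ | ⟨h1, h2⟩
  · exact Fin.succ_injective _ h
  · exact absurd (h1 ▸ hq i) (h2 ▸ (hq j).asymm)

theorem card_parentGraph_edgeSet (p : ∀ i : Fin k, Fin (i + 1)) :
    Nat.card (parentGraph p).edgeSet = k := by
  have h : (parentGraph p).edgeSet = Set.range fun i : Fin k => s(parentVertex p i, i.succ) := by
    ext e
    induction e using Sym2.ind with
    | _ a b =>
      rw [SimpleGraph.mem_edgeSet]
      constructor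
      · rintro ⟨i, ⟨rfl, h⟩ | ⟨rfl, h⟩⟩
        · exact ⟨i, by rw [show a = parentVertex p i from Fin.ext h]⟩
        · exact ⟨i, by rw [show b = parentVertex p i from Fin.ext h, Sym2.eq_swap]⟩
      · rintro ⟨i, h⟩
        rw [← SimpleGraph.mem_edgeSet, ← h]
        exact parentGraph_adj_succ p i
  rw [h, Nat.card_range_of_injective (succ_edge_injective (parentVertex_lt p)), Nat.card_fin]

theorem parentGraph_isTree (p : ∀ i : Fin k, Fin (i + 1)) : (parentGraph p).IsTree :=
  SimpleGraph.isTree_iff_connected_and_card.2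
    ⟨parentGraph_connected p, by rw [card_parentGraph_edgeSet, Nat.card_fin]⟩

theorem exists_adj_dist_add_one {V : Type*} {G : SimpleGraph V} (hG : G.Connected) {r v : V}
    (hv : v ≠ r) : ∃ w, G.Adj w v ∧ G.dist r w + 1 = G.dist r v := by
  obtain ⟨p, hp⟩ := hG.exists_walk_length_eq_dist v r
  cases p with
  | nil => exact absurd rfl hv
  | cons h p =>
    rename_i w
    refine ⟨w, h.symm, ?_⟩
    have h1 := G.dist_le p
    rw [SimpleGraph.Walk.length_cons, SimpleGraph.dist_comm] at hp
    rw [SimpleGraph.dist_comm] at h1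
    have h2 := hG.dist_triangle (u := r) (v := w) (w := v)
    rw [SimpleGraph.dist_eq_one_iff_adj.2 h.symm] at h2
    omega

/-- Some neighbour w of the vertex is closer to 0. A smaller neighbour can only be the parent. If w
were larger, the vertex would be the parent of w and, by induction on the distance, closer to 0 than
w, which is absurd. -/
theorem dist_parentVertex (p : ∀ i : Fin k, Fin (i + 1)) (d : ℕ) : ∀ i : Fin k,
    (parentGraph p).dist 0 i.succ = d →
    (parentGraph p).dist 0 (parentVertex p i) < (parentGraph p).dist 0 i.succ := by
  induction d using Nat.strong_induction_on with
  | _ d ih =>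
    intro i hd
    obtain ⟨w, hw, hdw⟩ := exists_adj_dist_add_one (parentGraph_connected p) (Fin.succ_ne_zero i)
    rcases lt_or_gt_of_ne hw.ne with hlt | hlt
    · obtain ⟨j, hj, rfl⟩ := parentGraph_adj_of_lt hw hlt
      rw [Fin.succ_inj] at hj
      subst hj
      omega
    · obtain ⟨j, rfl, hj⟩ := parentGraph_adj_of_lt hw.symm hlt
      have := ih _ (by omega) j rfl
      rw [← hj] at this
      omega

/-- The increasing tree with parent function `p`. -/
def parentTree (p : ∀ i : Fin k, Fin (i + 1)) : {T : RootedTree (k + 1) // T.IsIncreasing} :=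
  ⟨⟨parentGraph p, parentGraph_isTree p, 0⟩, by
    intro a b hab hd
    by_contra hlt
    obtain ⟨i, rfl, rfl⟩ := parentGraph_adj_of_lt hab.symm
      (lt_of_le_of_ne (not_lt.1 hlt) hab.ne.symm)
    exact lt_asymm hd (dist_parentVertex p _ i rfl)⟩

theorem parentTree_injective : Function.Injective (parentTree (k := k)) := by
  intro p q h
  have hg : parentGraph p = parentGraph q := congrArg (fun T => T.1.graph) h
  funext i
  have hi := parentGraph_adj_succ p i
  rw [hg] at hi
  obtain ⟨j, hj, h⟩ := parentGraph_adj_of_lt hi (parentVertex_lt p i)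
  rw [Fin.succ_inj] at hj
  subst hj
  exact Fin.ext (Fin.mk.inj h)

theorem parentTree_surjective : Function.Surjective (parentTree (k := k)) := by
  rintro ⟨⟨G, hG, r⟩, hT⟩
  have key : ∀ v, v ≠ r → ∃ w, G.Adj w v ∧ w < v := fun v hv => by
    obtain ⟨w, hw, hd⟩ := exists_adj_dist_add_one hG.connected hv
    exact ⟨w, hw, hT w v hw (by change G.dist r w < G.dist r v; omega)⟩
  -- Every vertex but the root has a smaller neighbour, and 0 has none.
  have hr : r = 0 := by
    by_contra h
    obtain ⟨w, -, hw⟩ := key 0 (Ne.symm h)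
    exact (Fin.not_lt_zero w) hw
  subst hr
  choose q hq hlt using fun i : Fin k => key i.succ (Fin.succ_ne_zero i)
  let p : ∀ i : Fin k, Fin (i + 1) := fun i => ⟨q i, hlt i⟩
  have hle : parentGraph p ≤ G := by
    rintro a b ⟨i, ⟨rfl, h⟩ | ⟨rfl, h⟩⟩
    · rw [show a = q i from Fin.ext h]; exact hq i
    · rw [show b = q i from Fin.ext h]; exact (hq i).symm
  -- A tree is minimal among connected graphs, so it equals its connected subgraph of chosen parent
  -- edges.
  have heq : parentGraph p = G :=
    le_antisymm hle ((SimpleGraph.isTree_iff_minimal_connected.1 hG).2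
      (parentGraph_connected p) hle)
  refine ⟨p, ?_⟩
  subst heq
  rfl

theorem card_increasing_trees :
    Nat.card {T : RootedTree (k + 1) // T.IsIncreasing} = k ! := by
  rw [← Nat.card_eq_of_bijective _ ⟨parentTree_injective (k := k), parentTree_surjective⟩,
    Nat.card_eq_fintype_card, Fintype.card_pi]
  simp only [Fintype.card_fin]
  rw [Fin.prod_univ_eq_prod_range (fun i => i + 1), Finset.prod_range_add_one_eq_factorial]

end Trees

end CompatibleLie

theorem mainTheorem11 (R : Type*) [CommRing R] (n : ℕ) (hn : 1 ≤ n) :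
    (∃ f : CompatibleLie.lie R n ≃ₗ[R] CompatibleLie.lieTwoPart R n (n - 1),
      ∀ (m : CompatibleLie.Mono Unit (Fin n)) (hm : m.IsMultilinear),
        ((f ⟨CompatibleLie.mono R m, CompatibleLie.mono_mem_lie R hm⟩ :
            CompatibleLie.lieTwo R n) : CompatibleLie.FreeLieTwo R n)
          = CompatibleLie.mono R (m.paint CompatibleLie.Color.red)) ∧
    Nonempty (Module.Basis (Fin (n - 1)!) R (CompatibleLie.lie R n)) ∧
    Nonempty (Module.Basis (Fin (n - 1)!) R (CompatibleLie.lieTwoPart R n (n - 1))) ∧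
    Nat.card {T : CompatibleLie.RootedTree n // T.IsIncreasing} = (n - 1)! := by
  obtain ⟨k, rfl⟩ : ∃ k, n = k + 1 := ⟨n - 1, by omega⟩
  obtain ⟨b⟩ := CompatibleLie.nonempty_basis_lie R (k + 1)
  refine ⟨⟨CompatibleLie.lieEquiv R hn, fun m hm => ?_⟩, ⟨b⟩,
    ⟨b.map (CompatibleLie.lieEquiv R hn)⟩, CompatibleLie.card_increasing_trees⟩
  rw [CompatibleLie.coe_lieEquiv, CompatibleLie.paintRed_mono]
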